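/- Let $J\ge 2$ and $1\le J_0\le J-1$ be integers, and let $\mathcal Z=\{0,J_0,J_0+1,\dots,J-1\}$. Consider latent variables consisting of potential outcomes $Y_0,\dots,Y_{J-1}\in\mathbf R$, potential treatments $D_z\in\{0,\dots,J-1\}$ for $z\in\mathcal Z$, and an instrument $Z\in\mathcal Z$. Let $T$ be the map that sends $(Y_0,\dots,Y_{J-1},(D_z)_{z\in\mathcal Z},Z)$ to $(Y,D,Z)$, where $$D=\sum_{z\in\mathcal Z}D_z\,I\{Z=z\},\qquad Y=\sum_{0\le d\le J-1}Y_d\,I\{D=d\}.$$ Let $\mathbf Q_1^Y$ be the set of all probability distributions $Q$ of $(Y_0,\dots,Y_{J-1},(D_z)_{z\in\mathcal Z},Z)$ such that 1. $(Y_0,\dots,Y_{J-1},(D_z)_{z\in\mathcal Z})$ is independent of $Z$ under $Q$; 2. $Q\{Z=z\}>0$ for every $z\in\mathcal Z$; 3. there is a random variable $j^*$ with values in $\{0,\dots,J-1\}$ such that $Q\{j^*=D_0\}=1$ and $Q\{D_z\in\{z,j^*\}\}=1$ for every $z\in\mathcal Z$ (equivalently, $Q\{D_z\in\{z,D_0\}\}=1$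 for all $J_0\le z\le J-1$). Let $P$ be a probability distribution of $(Y,D,Z)$ on $\mathbf R\times\{0,\dots,J-1\}\times\mathcal Z$ such that $P\{Z=z\}>0$ for every $z\in\mathcal Z$, and let $\mathcal Y$ be the support of $Y$ under $P$, that is, the intersection of all closed sets $F\subseteq\mathbf R$ with $P\{Y\in F\}=1$. Then $P=QT^{-1}$ for some $Q\in\mathbf Q_1^Y$ if and only if both of the following hold: (i) for every Borel set $B\subseteq\mathcal Y$, every $J_0\le j\le J-1$ and every $k\in\mathcal Z$ with $k\ne j$, $$P\{Y\in B,D=j\mid Z=k\}\le P\{Y\in B,D=j\mid Z=j\};$$ (ii) for every Borel set $B\subseteq\mathcal Y$, every $0\le j\le J-1$ and every $J_0\le k\le J-1$ with $k\ne j$, $$P\{Y\in B,D=j\mid Z=k\}\le P\{Y\in B,D=j\mid Z=0\}.$$ -/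

import Mathlib

open MeasureTheory ProbabilityTheory

namespace Encouragement

/-- The set of instrument values: `{0, J₀, …, J - 1}` if `J₀ > 0`, and `{0, …, J - 1}` if
`J₀ = 0`. -/
def InstrValues (J J₀ : ℕ) [NeZero J] : Set (Fin J) :=
  {z | z = 0 ∨ J₀ ≤ z.val}

/-- The instrument value `0`. -/
def base (J J₀ : ℕ) [NeZero J] : InstrValues J J₀ := ⟨0, Or.inl rfl⟩

/-- The space in which the observed vector `(Y, D, Z)` takes its values. -/
abbrev Observed (J J₀ : ℕ) [NeZero J] : Type :=
  ℝ × Fin J × InstrValues J J₀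

/-- The space in which the latent vector `((Y_0, …, Y_{J-1}), (D_z : z ∈ 𝒵), Z)` takes its
values. -/
abbrev Latent (J J₀ : ℕ) [NeZero J] : Type :=
  (Fin J → ℝ) × (InstrValues J J₀ → Fin J) × InstrValues J J₀

/-- The map `T` from latent to observed variables: `D = D_Z`, that is `D = ∑ z, D_z 1{Z = z}`, and
`Y = Y_D`, that is `Y = ∑ d, Y_d 1{D = d}`. -/
def observe (J J₀ : ℕ) [NeZero J] (ω : Latent J J₀) : Observed J J₀ :=
  (ω.1 (ω.2.1 ω.2.2), ω.2.1 ω.2.2, ω.2.2)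

theorem measurable_observe (J J₀ : ℕ) [NeZero J] : Measurable (observe J J₀) := by
  have hD : Measurable fun ω : Latent J J₀ => ω.2.1 ω.2.2 := by
    have h : Measurable fun q : (InstrValues J J₀ → Fin J) × InstrValues J J₀ => q.1 q.2 :=
      measurable_from_prod_countable_left fun z => measurable_pi_apply z
    exact h.comp measurable_snd
  have hY : Measurable fun ω : Latent J J₀ => ω.1 (ω.2.1 ω.2.2) := by
    have h : Measurable fun q : (Fin J → ℝ) × Fin J => q.1 q.2 :=
      measurable_from_prod_countable_left fun d => measurable_pi_apply d
    exact h.comp (measurable_fst.prodMk hD)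
  exact hY.prodMk (hD.prodMk (measurable_snd.comp measurable_snd))

/-- The model with an outcome: the set of all distributions `Q` of the latent vector
`((Y_d), (D_z), Z)` under which the instrument is exogenous and has full support, and every
potential treatment `D_z` is either the targeted choice `z` or a random default choice `j*`, which
is the potential treatment `D_0` in the presence of a base state (`J₀ > 0`). -/
structure IsModel (J J₀ : ℕ) [NeZero J] (Q : Measure (Latent J J₀)) : Prop where
  isProbabilityMeasure : IsProbabilityMeasure Q
  exogeneity : IndepFun (fun ω : Latent J J₀ => (ω.1, ω.2.1)) (fun ω : Latent J J₀ => ω.2.2) Q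
  overlap : ∀ z : InstrValues J J₀, 0 < Q {ω | ω.2.2 = z}
  default_choice : ∃ jstar : Latent J J₀ → Fin J, Measurable jstar ∧
    (0 < J₀ → ∀ᵐ ω ∂Q, jstar ω = ω.2.1 (base J J₀)) ∧
    ∀ z : InstrValues J J₀, ∀ᵐ ω ∂Q, ω.2.1 z = z.val ∨ ω.2.1 z = jstar ω

/-- The model as a set of distributions. -/
def Model (J J₀ : ℕ) [NeZero J] : Set (Measure (Latent J J₀)) := {Q | IsModel J J₀ Q}

variable {J J₀ : ℕ} [NeZero J]

/-- The support `𝒴` of `Y` under `P`: the intersection of all closed sets of probability one. -/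
def outcomeSupport (P : Measure (Observed J J₀)) : Set ℝ :=
  ⋂₀ {F : Set ℝ | IsClosed F ∧ P {p | p.1 ∈ F} = 1}

/-- `P{Y ∈ B, D = j | Z = z}`. -/
noncomputable def condProb (P : Measure (Observed J J₀)) (B : Set ℝ) (j : Fin J)
    (z : InstrValues J J₀) : ENNReal :=
  ProbabilityTheory.cond P {p | p.2.2 = z} {p | p.1 ∈ B ∧ p.2.1 = j}

/-- Each targeted choice `j` is most likely, jointly with any event about `Y`, under the instrument
value `j`. -/
def TargetDominates (P : Measure (Observed J J₀)) : Prop :=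
  ∀ B : Set ℝ, MeasurableSet B → B ⊆ outcomeSupport P →
    ∀ j : InstrValues J J₀, J₀ ≤ j.val.val → ∀ k : InstrValues J J₀, k ≠ j →
      condProb P B j.val k ≤ condProb P B j.val j

/-- Each choice `j` is, jointly with any event about `Y`, at least as likely under the base state as
under any instrument value that targets another choice. -/
def BaseDominates (P : Measure (Observed J J₀)) : Prop :=
  ∀ B : Set ℝ, MeasurableSet B → B ⊆ outcomeSupport P →
    ∀ j : Fin J, ∀ k : InstrValues J J₀, J₀ ≤ k.val.val → j ≠ k.val →
      condProb P B j k ≤ condProb P B j (base J J₀)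

end Encouragement

/-! Necessity: if `D_k = j` with `k ≠ j`, then `j* = j`, which forces both `D_j = j` and `D_0 = j`.
These are inclusions of events up to null sets, and exogeneity turns their probabilities into
conditional ones.

Sufficiency: let `p` and `q_z` be the laws of `(Y, D)` given `Z = 0` and `Z = z`. For `z ≠ 0` the
inequalities give `q_z ≤ p` on `D ≠ z` and `p ≤ q_z` on `D = z`. Hence `q_z` arises from `p` by
keeping a point with `D ≠ z` with probability `dq_z/dp`, and otherwise redrawing it from the
normalised excess on `D = z` (`exists_map_switch_eq`). All switches start from one default pair with
law `p`. They are compatible because `D_z` is the default choice or `z`, so a single `Y_d` can serve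
as the default outcome or as the draw for the one instrument value targeting `d` (`potential`). An
independent `Z` completes `Q` (`map_observe_attachInstr`). -/

namespace Encouragement

/-! ### Transporting one law to another by partial redrawing -/

/-- Replace `x` by the fresh draw `w` when `x` lies in `A` and the threshold `f x` is exceeded. -/
noncomputable def switch {α : Type*} (A : Set α) (f : α → unitInterval)
    (t : α × unitInterval × α) : α :=
  open Classical in if t.1 ∈ A ∧ f t.1 < t.2.1 then t.2.2 else t.1

theorem measurable_switch {α : Type*} [MeasurableSpace α] {A : Set α} (hA : MeasurableSet A)
    {f : α → unitInterval} (hf : Measurable f) : Measurable (switch A f) := by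
  unfold switch
  refine Measurable.ite ?_ (by fun_prop) measurable_fst
  exact (measurable_fst hA).inter
    (measurableSet_lt (f := fun t : α × unitInterval × α => f t.1)
      (g := fun t : α × unitInterval × α => t.2.1) (by fun_prop) (by fun_prop))

/-- The law of `switch`: the mass kept, plus the mass of `A` lost to the threshold times `ν`. -/
theorem map_switch_apply {α : Type*} [MeasurableSpace α] (p ν : Measure α)
    [IsProbabilityMeasure p] [IsProbabilityMeasure ν] {A : Set α} (hA : MeasurableSet A)
    {f : α → unitInterval} (hf : Measurable f) {S : Set α} (hS : MeasurableSet S) :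
    Measure.map (switch A f) (p.prod ((volume : Measure unitInterval).prod ν)) S =
      p (S ∩ Aᶜ) + (∫⁻ x in S ∩ A, ENNReal.ofReal (f x) ∂p
        + (∫⁻ x in A, (1 - ENNReal.ofReal (f x)) ∂p) * ν S) := by
  classical
  have hm := measurable_switch hA hf
  have hg : Measurable fun x => ENNReal.ofReal (f x) := by fun_prop
  have hg' : Measurable fun x => 1 - ENNReal.ofReal (f x) := by fun_prop
  rw [Measure.map_apply hm hS, Measure.prod_apply (hm hS)]
  have key : ∀ x, (volume.prod ν) (Prod.mk x ⁻¹' (switch A f ⁻¹' S)) =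
      (S ∩ Aᶜ).indicator 1 x + ((S ∩ A).indicator (fun x => ENNReal.ofReal (f x)) x
        + A.indicator (fun x => 1 - ENNReal.ofReal (f x)) x * ν S) := by
    intro x
    have hcompl : (volume : Measure unitInterval) (Set.Ioi (f x)) =
        1 - ENNReal.ofReal (f x) := by
      rw [← Set.compl_Iic, prob_compl_eq_one_sub measurableSet_Iic, unitInterval.volume_Iic]
    by_cases hxA : x ∈ A
    · by_cases hxS : x ∈ S
      · have : Prod.mk x ⁻¹' (switch A f ⁻¹' S) =
            Set.Iic (f x) ×ˢ Set.univ ∪ Set.Ioi (f x) ×ˢ S := by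
          ext ⟨u, w⟩
          by_cases h : f x < u
          · simp [switch, hxA, h]
          · simp [switch, hxA, h, hxS, not_lt.1 h]
        rw [this, measure_union _ (measurableSet_Ioi.prod hS), Measure.prod_prod,
          Measure.prod_prod, hcompl, unitInterval.volume_Iic]
        · simp [hxA, hxS]
        · exact Set.disjoint_left.2 fun t h1 h2 => not_lt.2 (Set.mem_Iic.1 h1.1) h2.1
      · have : Prod.mk x ⁻¹' (switch A f ⁻¹' S) = Set.Ioi (f x) ×ˢ S := by
          ext ⟨u, w⟩
          by_cases h : f x < u
          · simp [switch, hxA, h]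
          · simp [switch, hxA, h, hxS]
        rw [this, Measure.prod_prod, hcompl]
        simp [hxA, hxS]
    · by_cases hxS : x ∈ S
      · have : Prod.mk x ⁻¹' (switch A f ⁻¹' S) = Set.univ := by
          ext ⟨u, w⟩
          simp [switch, hxA, hxS]
        rw [this]
        simp [hxA, hxS]
      · have : Prod.mk x ⁻¹' (switch A f ⁻¹' S) = ∅ := by
          ext ⟨u, w⟩
          simp [switch, hxA, hxS]
        rw [this]
        simp [hxA, hxS]
  simp_rw [key]
  rw [lintegral_add_left (measurable_one.indicator (hS.inter hA.compl)),
    lintegral_add_left (hg.indicator (hS.inter hA)),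
    lintegral_mul_const _ (hg'.indicator hA),
    lintegral_indicator_one (hS.inter hA.compl), lintegral_indicator (hS.inter hA),
    lintegral_indicator hA]

/-- If `q ≤ p` on `A` and `p ≤ q` off `A`, then `q` is obtained from `p` by redrawing part of the
mass on `A` from a law concentrated off `A`. -/
theorem exists_map_switch_eq {α : Type*} [MeasurableSpace α] (p q : Measure α)
    [IsProbabilityMeasure p] [IsProbabilityMeasure q] {A : Set α} (hA : MeasurableSet A)
    (hne : Aᶜ.Nonempty) (hqp : q.restrict A ≤ p.restrict A)
    (hpq : p.restrict Aᶜ ≤ q.restrict Aᶜ) :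
    ∃ (f : α → unitInterval) (ν : Measure α), Measurable f ∧ IsProbabilityMeasure ν ∧ ν A = 0 ∧
      Measure.map (switch A f) (p.prod ((volume : Measure unitInterval).prod ν)) = q := by
  obtain ⟨f, hf, hfq⟩ : ∃ f : α → unitInterval, Measurable f ∧
      ∀ S, MeasurableSet S → ∫⁻ x in S ∩ A, ENNReal.ofReal (f x) ∂p = q (S ∩ A) := by
    -- The keeping probability is the density of `q` with respect to `p` on `A`; it is almost
    -- everywhere at most one, so the projection to `[0, 1]` changes nothing there.
    set r := (q.restrict A).rnDeriv (p.restrict A)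
    have hr : Measurable r := Measure.measurable_rnDeriv _ _
    have hr1 : r ≤ᵐ[p.restrict A] 1 := Measure.rnDeriv_le_one_of_le hqp
    refine ⟨fun x => Set.projIcc 0 1 zero_le_one (r x).toReal,
      continuous_projIcc.measurable.comp hr.ennreal_toReal, fun S hS => ?_⟩
    have h1 : ∫⁻ x in S, r x ∂(p.restrict A) = q (S ∩ A) := by
      rw [Measure.setLIntegral_rnDeriv' (Measure.absolutelyContinuous_of_le hqp) hS,
        Measure.restrict_apply hS]
    rw [← h1, Measure.restrict_restrict hS]
    refine lintegral_congr_ae ?_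
    filter_upwards [ae_mono (Measure.restrict_mono Set.inter_subset_right le_rfl) hr1] with x hx
    have hx' : r x ≤ 1 := hx
    have h2 : (r x).toReal ≤ 1 := ENNReal.toReal_mono ENNReal.one_ne_top hx' |>.trans (by simp)
    rw [Set.projIcc_of_mem zero_le_one ⟨ENNReal.toReal_nonneg, h2⟩]
    exact ENNReal.ofReal_toReal (ne_top_of_le_ne_top ENNReal.one_ne_top hx')
  have hlost : ∫⁻ x in A, (1 - ENNReal.ofReal (f x)) ∂p = p A - q A := by
    have h := hfq A hA
    rw [Set.inter_self] at h
    rw [lintegral_sub (by fun_prop) (by rw [h]; finiteness)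
      (ae_of_all _ fun x => by simpa using (f x).2.2), h]
    simp
  -- Both masses are one, so what `A` loses is exactly what its complement gains.
  have hpqA : p A - q A = q Aᶜ - p Aᶜ := by
    have h1 : q A ≤ p A := by simpa using hqp A
    have h2 : p Aᶜ ≤ q Aᶜ := by simpa using hpq Aᶜ
    rw [prob_compl_eq_one_sub hA, prob_compl_eq_one_sub hA]
    have hp : p A ≤ 1 := prob_le_one
    rw [ENNReal.sub_sub_sub_cancel_left ENNReal.one_ne_top hp]
  set d := q.restrict Aᶜ - p.restrict Aᶜ with hd
  have hdS : ∀ S, MeasurableSet S → d S = q (S ∩ Aᶜ) - p (S ∩ Aᶜ) := fun S hS => by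
    rw [hd, Measure.sub_apply hS hpq, Measure.restrict_apply hS, Measure.restrict_apply hS]
  have hduniv : d Set.univ = p A - q A := by
    rw [hdS _ MeasurableSet.univ, Set.univ_inter, hpqA]
  obtain ⟨ν, hν, hνA, hνd⟩ : ∃ ν : Measure α, IsProbabilityMeasure ν ∧ ν A = 0 ∧
      ∀ S, d Set.univ * ν S = d S := by
    by_cases h0 : d Set.univ = 0
    -- With no excess nothing is redrawn, and any law off `A` will do.
    · obtain ⟨a, ha⟩ := hne
      refine ⟨Measure.dirac a, inferInstance, ?_, fun S => ?_⟩
      · rw [Measure.dirac_apply' _ hA, Set.indicator_of_notMem ha]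
      · rw [h0, zero_mul, Measure.measure_univ_eq_zero.1 h0]; rfl
    · have ht : d Set.univ ≠ ⊤ := by rw [hduniv]; finiteness
      refine ⟨(d Set.univ)⁻¹ • d, ⟨?_⟩, ?_, fun S => ?_⟩
      · simp [ENNReal.inv_mul_cancel h0 ht]
      · simp [hdS A hA]
      · rw [Measure.smul_apply, smul_eq_mul, ← mul_assoc, ENNReal.mul_inv_cancel h0 ht, one_mul]
  refine ⟨f, ν, hf, hν, hνA, Measure.ext fun S hS => ?_⟩
  have hle : p (S ∩ Aᶜ) ≤ q (S ∩ Aᶜ) := by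
    simpa [Measure.restrict_apply hS] using hpq S
  -- The terms are `p (S ∩ Aᶜ)`, `q (S ∩ A)` and the excess of `q` over `p` on `S ∩ Aᶜ`.
  rw [map_switch_apply p ν hA hf hS, hfq S hS, hlost, ← hduniv, hνd, hdS S hS, add_left_comm,
    add_tsub_cancel_of_le hle]
  exact measure_inter_add_sdiff S hA

/-! ### Necessity of the inequalities -/

variable {J J₀ : ℕ} [NeZero J]

theorem measurableSet_instr (z : InstrValues J J₀) :
    MeasurableSet {p : Observed J J₀ | p.2.2 = z} :=
  measurableSet_eq_fun (by fun_prop) measurable_const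

theorem measurableSet_outcome_choice {B : Set ℝ} (hB : MeasurableSet B) (j : Fin J) :
    MeasurableSet {p : Observed J J₀ | p.1 ∈ B ∧ p.2.1 = j} :=
  (measurable_fst hB).inter (measurableSet_eq_fun (by fun_prop) measurable_const)

/-- In the model, conditioning on the instrument value `z` reveals the law of `(Y_{D_z}, D_z)`. -/
theorem IsModel.condProb_map_observe {Q : Measure (Latent J J₀)} (hQ : IsModel J J₀ Q)
    {B : Set ℝ} (hB : MeasurableSet B) (j : Fin J) (z : InstrValues J J₀) :
    condProb (Measure.map (observe J J₀) Q) B j z = Q {ω | ω.1 j ∈ B ∧ ω.2.1 z = j} := by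
  have := hQ.isProbabilityMeasure
  have hm := measurable_observe J J₀
  have hz : MeasurableSet {ω : Latent J J₀ | ω.2.2 = z} :=
    measurableSet_eq_fun (by fun_prop) measurable_const
  have hE : MeasurableSet {q : (Fin J → ℝ) × (InstrValues J J₀ → Fin J) |
      q.1 j ∈ B ∧ q.2 z = j} :=
    (((measurable_pi_apply j).comp measurable_fst) hB).inter
      (measurableSet_eq_fun (by fun_prop) measurable_const)
  have hind := hQ.exogeneity.measure_inter_preimage_eq_mul _ {z} hE (measurableSet_singleton z)
  rw [condProb, cond_apply (measurableSet_instr z), Measure.map_apply hm (measurableSet_instr z),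
    Measure.map_apply hm ((measurableSet_instr z).inter (measurableSet_outcome_choice hB j))]
  have hset : observe J J₀ ⁻¹' ({p | p.2.2 = z} ∩ {p | p.1 ∈ B ∧ p.2.1 = j}) =
      (fun ω : Latent J J₀ => (ω.1, ω.2.1)) ⁻¹' {q | q.1 j ∈ B ∧ q.2 z = j} ∩
        (fun ω : Latent J J₀ => ω.2.2) ⁻¹' {z} := by
    ext ⟨y, d, k⟩
    simp only [observe, Set.mem_preimage, Set.mem_inter_iff, Set.mem_ofPred_eq,
      Set.mem_singleton_iff]
    constructor
    · rintro ⟨rfl, h, rfl⟩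
      exact ⟨⟨h, rfl⟩, rfl⟩
    · rintro ⟨⟨h, rfl⟩, rfl⟩
      exact ⟨rfl, h, rfl⟩
  rw [hset, hind, mul_comm (Q _) (Q _), ← mul_assoc]
  change (Q {ω | ω.2.2 = z})⁻¹ * Q {ω | ω.2.2 = z} * _ = _
  rw [ENNReal.inv_mul_cancel (hQ.overlap z).ne' (measure_ne_top _ _), one_mul]
  rfl

theorem IsModel.targetDominates {Q : Measure (Latent J J₀)} (hQ : IsModel J J₀ Q) :
    TargetDominates (Measure.map (observe J J₀) Q) := by
  intro B hB _ j _ k hkj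
  rw [hQ.condProb_map_observe hB, hQ.condProb_map_observe hB]
  obtain ⟨s, -, -, hs⟩ := hQ.default_choice
  refine measure_mono_ae ?_
  filter_upwards [hs j, hs k] with ω hj hk ⟨hB, hD⟩
  refine ⟨hB, hj.elim id fun h => ?_⟩
  -- Since `D_k = j ≠ k`, the default choice is `j`, and then both options for `D_j` equal `j`.
  rcases hk with hk | hk
  · exact absurd (Subtype.ext (hk.symm.trans hD)) hkj
  · rw [h, ← hk, hD]

theorem IsModel.baseDominates (hJ₀ : 0 < J₀) {Q : Measure (Latent J J₀)} (hQ : IsModel J J₀ Q) :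
    BaseDominates (Measure.map (observe J J₀) Q) := by
  intro B hB _ j k _ hjk
  rw [hQ.condProb_map_observe hB, hQ.condProb_map_observe hB]
  obtain ⟨s, -, hs0, hs⟩ := hQ.default_choice
  refine measure_mono_ae ?_
  filter_upwards [hs0 hJ₀, hs k] with ω h0 hk ⟨hB, hD⟩
  refine ⟨hB, ?_⟩
  rcases hk with hk | hk
  · exact absurd (hD.symm.trans hk) hjk
  · rw [← h0, ← hk, hD]

/-! ### Removing the support restriction; conditional laws -/

/-- The identification is needed because the topological support of a measure on the line carries
full measure. -/
theorem outcomeSupport_eq_support (P : Measure (Observed J J₀)) [IsProbabilityMeasure P] :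
    outcomeSupport P = (P.map Prod.fst).support := by
  have hm : Measurable (Prod.fst : Observed J J₀ → ℝ) := measurable_fst
  rw [Measure.support_eq_sInter, outcomeSupport]
  congr 1
  ext F
  refine and_congr_right fun hF => ?_
  rw [Measure.map_apply hm hF.measurableSet.compl, Set.preimage_compl,
    prob_compl_eq_zero_iff (hm hF.measurableSet)]
  rfl

/-- Events about `Y` only matter up to their trace on the support of `Y`. -/
theorem condProb_inter_outcomeSupport (P : Measure (Observed J J₀)) [IsProbabilityMeasure P]
    (B : Set ℝ) (j : Fin J) (z : InstrValues J J₀) :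
    condProb P (B ∩ outcomeSupport P) j z = condProb P B j z := by
  refine measure_congr ?_
  have h : ∀ᵐ p ∂P, p.1 ∈ outcomeSupport P := by
    have : ∀ᵐ y ∂(P.map Prod.fst), y ∈ outcomeSupport P := by
      rw [outcomeSupport_eq_support]
      exact Measure.support_mem_ae
    exact ae_of_ae_map measurable_fst.aemeasurable this
  filter_upwards [cond_absolutelyContinuous.ae_le h] with p hp
  exact propext ⟨fun hq => ⟨hq.1.1, hq.2⟩, fun hq => ⟨⟨hq.1, hp⟩, hq.2⟩⟩

theorem measurableSet_outcomeSupport (P : Measure (Observed J J₀)) :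
    MeasurableSet (outcomeSupport P) :=
  (isClosed_sInter fun _ hF => hF.1).measurableSet

theorem TargetDominates.condProb_le {P : Measure (Observed J J₀)} [IsProbabilityMeasure P]
    (h : TargetDominates P) {B : Set ℝ} (hB : MeasurableSet B) {j k : InstrValues J J₀}
    (hj : J₀ ≤ j.val.val) (hkj : k ≠ j) : condProb P B j.val k ≤ condProb P B j.val j := by
  rw [← condProb_inter_outcomeSupport P B, ← condProb_inter_outcomeSupport P B]
  exact h _ (hB.inter (measurableSet_outcomeSupport P)) Set.inter_subset_right j hj k hkj

theorem BaseDominates.condProb_le {P : Measure (Observed J J₀)} [IsProbabilityMeasure P]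
    (h : BaseDominates P) {B : Set ℝ} (hB : MeasurableSet B) {j : Fin J} {k : InstrValues J J₀}
    (hk : J₀ ≤ k.val.val) (hjk : j ≠ k.val) :
    condProb P B j k ≤ condProb P B j (base J J₀) := by
  rw [← condProb_inter_outcomeSupport P B, ← condProb_inter_outcomeSupport P B]
  exact h _ (hB.inter (measurableSet_outcomeSupport P)) Set.inter_subset_right j k hk hjk

/-- The law of `(Y, D)` given `Z = z`. -/
noncomputable def condLaw (P : Measure (Observed J J₀)) (z : InstrValues J J₀) :
    Measure (ℝ × Fin J) :=
  Measure.map (fun p => (p.1, p.2.1)) (ProbabilityTheory.cond P {p | p.2.2 = z})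

theorem measurable_outcome_choice :
    Measurable fun p : Observed J J₀ => (p.1, p.2.1) := by fun_prop

theorem isProbabilityMeasure_condLaw (P : Measure (Observed J J₀)) [IsProbabilityMeasure P]
    {z : InstrValues J J₀} (hz : 0 < P {p | p.2.2 = z}) :
    IsProbabilityMeasure (condLaw P z) := by
  have := cond_isProbabilityMeasure hz.ne'
  exact Measure.isProbabilityMeasure_map measurable_outcome_choice.aemeasurable

/-- The law of `(Y, D)` given `Z = z` is the sum of its slices `D = j`. -/
theorem condLaw_apply (P : Measure (Observed J J₀)) (z : InstrValues J J₀)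
    {S : Set (ℝ × Fin J)} (hS : MeasurableSet S) :
    condLaw P z S = ∑ j, condProb P {y | (y, j) ∈ S} j z := by
  have hsec : ∀ j : Fin J, MeasurableSet {y | (y, j) ∈ S} := fun j =>
    (measurable_id.prodMk measurable_const) hS
  rw [condLaw, Measure.map_apply measurable_outcome_choice hS]
  have hU : (fun p : Observed J J₀ => (p.1, p.2.1)) ⁻¹' S =
      ⋃ j, {p : Observed J J₀ | p.1 ∈ {y | (y, j) ∈ S} ∧ p.2.1 = j} := by
    ext ⟨y, d, k⟩
    simp
  rw [hU, measure_iUnion _ fun j => measurableSet_outcome_choice (hsec j) j, tsum_fintype]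
  · rfl
  · exact fun i j hij => Set.disjoint_left.2 fun p hi hj => hij (hi.2.symm.trans hj.2)

/-- There are finitely many choices, so domination of measures can be checked slice by slice. -/
theorem condLaw_restrict_le {P : Measure (Observed J J₀)} {z w : InstrValues J J₀}
    {T : Set (Fin J)}
    (h : ∀ j ∈ T, ∀ B, MeasurableSet B → condProb P B j z ≤ condProb P B j w) :
    (condLaw P z).restrict (Prod.snd ⁻¹' T) ≤ (condLaw P w).restrict (Prod.snd ⁻¹' T) := by
  have hT : MeasurableSet (Prod.snd ⁻¹' T : Set (ℝ × Fin J)) :=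
    measurable_snd (Set.toFinite T).measurableSet
  refine Measure.le_iff.2 fun S hS => ?_
  rw [Measure.restrict_apply hS, Measure.restrict_apply hS, condLaw_apply _ _ (hS.inter hT),
    condLaw_apply _ _ (hS.inter hT)]
  refine Finset.sum_le_sum fun j _ => ?_
  by_cases hj : j ∈ T
  · exact h j hj _ ((measurable_id.prodMk measurable_const) (hS.inter hT))
  · simp [hj, condProb]

theorem apply_inter_instr_eq (P : Measure (Observed J J₀)) [IsProbabilityMeasure P]
    {z : InstrValues J J₀} (hz : 0 < P {p | p.2.2 = z}) {S : Set (Observed J J₀)}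
    (hS : MeasurableSet S) :
    P ({p | p.2.2 = z} ∩ S) = P {p | p.2.2 = z} * condLaw P z {x | (x.1, x.2, z) ∈ S} := by
  have hsec : MeasurableSet {x : ℝ × Fin J | (x.1, x.2, z) ∈ S} :=
    (measurable_fst.prodMk (measurable_snd.prodMk measurable_const)) hS
  rw [condLaw, Measure.map_apply measurable_outcome_choice hsec,
    cond_apply (measurableSet_instr z), ← mul_assoc,
    ENNReal.mul_inv_cancel hz.ne' (measure_ne_top _ _), one_mul]
  congr 1
  ext ⟨y, d, k⟩
  simp only [Set.mem_inter_iff, Set.mem_ofPred_eq, Set.mem_preimage]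
  exact and_congr_right fun h => by rw [h]

/-! ### Construction of the potential outcomes and treatments -/

noncomputable instance : Fintype (InstrValues J J₀) := Fintype.ofFinite _

/-- The instrument value targeting the choice `d`, if there is one. -/
noncomputable def targeting (J J₀ : ℕ) [NeZero J] (d : Fin J) : InstrValues J J₀ :=
  open Classical in if h : d ∈ InstrValues J J₀ then ⟨d, h⟩ else base J J₀

theorem targeting_val (z : InstrValues J J₀) : targeting J J₀ z.val = z := by
  simp [targeting]

/-- The seeds of the latent variables: the default outcome and choice, a uniform threshold, and a
fresh draw for each instrument value. -/
abbrev Seed (J J₀ : ℕ) [NeZero J] : Type :=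
  (ℝ × Fin J) × unitInterval × (InstrValues J J₀ → ℝ × Fin J)

/-- The choices at which the instrument value `z` may change the default choice. -/
def movable (z : InstrValues J J₀) : Set (ℝ × Fin J) := Prod.snd ⁻¹' {z.val}ᶜ

theorem measurableSet_movable (z : InstrValues J J₀) : MeasurableSet (movable z) :=
  measurable_snd (Set.toFinite _).measurableSet

/-- The potential outcomes and treatments built from the seeds. -/
noncomputable def potential (f : InstrValues J J₀ → ℝ × Fin J → unitInterval) (s : Seed J J₀) :
    (Fin J → ℝ) × (InstrValues J J₀ → Fin J) :=
  open Classical in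
  -- When `d` is neither the default choice nor an instrument value, `Y_d` is never observed and its
  -- value is immaterial. One uniform threshold serves every `z`, as only the law at each separate
  -- `z` is constrained.
  (fun d => if s.1.2 = d then s.1.1 else (s.2.2 (targeting J J₀ d)).1,
    fun z => if s.1 ∈ movable z ∧ f z s.1 < s.2.1 then z.val else s.1.2)

theorem measurable_potential {f : InstrValues J J₀ → ℝ × Fin J → unitInterval}
    (hf : ∀ z, Measurable (f z)) : Measurable (potential f) := by
  refine (measurable_pi_lambda _ fun d => ?_).prodMk (measurable_pi_lambda _ fun z => ?_)
  · exact Measurable.ite (measurableSet_eq_fun (by fun_prop) measurable_const) (by fun_prop)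
      (by fun_prop)
  · have := hf z
    refine Measurable.ite ((measurable_fst (measurableSet_movable z)).inter
      (measurableSet_lt (f := fun s : Seed J J₀ => f z s.1)
        (g := fun s : Seed J J₀ => s.2.1) (by fun_prop) (by fun_prop)))
      measurable_const (by fun_prop)

/-- Under the instrument value `z`, the observed outcome and choice are the default ones, switched
to the draw attached to `z` when the threshold is exceeded. -/
theorem potential_apply_eq_switch (f : InstrValues J J₀ → ℝ × Fin J → unitInterval)
    {s : Seed J J₀} {z : InstrValues J J₀} (hs : s.2.2 z ∉ movable z) :
    ((potential f s).1 ((potential f s).2 z), (potential f s).2 z) =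
      switch (movable z) (f z) (s.1, s.2.1, s.2.2 z) := by
  have hs' : (s.2.2 z).2 = z.val := by simpa [movable] using hs
  by_cases h : s.1 ∈ movable z ∧ f z s.1 < s.2.1
  · have hne : s.1.2 ≠ z.val := h.1
    simp only [potential, switch, if_pos h, if_neg hne, targeting_val]
    exact Prod.ext rfl hs'.symm
  · simp [potential, switch, if_neg h]

/-- At a fixed `z` only the draw attached to `z` matters, so the product of the `ν` reduces to its
`z`-marginal; `hz` makes that draw carry the choice `z` almost surely. -/
theorem map_potential_eq (p : Measure (ℝ × Fin J)) [IsProbabilityMeasure p]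
    {f : InstrValues J J₀ → ℝ × Fin J → unitInterval} (hf : ∀ z, Measurable (f z))
    (ν : InstrValues J J₀ → Measure (ℝ × Fin J)) [∀ z, IsProbabilityMeasure (ν z)]
    (z : InstrValues J J₀) (hz : ν z (movable z) = 0) :
    Measure.map (fun s => ((potential f s).1 ((potential f s).2 z), (potential f s).2 z))
        (p.prod ((volume : Measure unitInterval).prod (Measure.pi ν))) =
      Measure.map (switch (movable z) (f z))
        (p.prod ((volume : Measure unitInterval).prod (ν z))) := by
  have hpres : MeasurePreserving (fun s : Seed J J₀ => (s.1, s.2.1, s.2.2 z))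
      (p.prod ((volume : Measure unitInterval).prod (Measure.pi ν)))
      (p.prod ((volume : Measure unitInterval).prod (ν z))) :=
    (MeasurePreserving.id p).prod ((MeasurePreserving.id _).prod (measurePreserving_eval ν z))
  have hae : ∀ᵐ s ∂(p.prod ((volume : Measure unitInterval).prod (Measure.pi ν))),
      s.2.2 z ∉ movable z := by
    have h1 : ∀ᵐ w ∂(ν z), w ∉ movable z := measure_eq_zero_iff_ae_notMem.1 hz
    have hq : MeasurePreserving (fun s : Seed J J₀ => s.2.2 z)
        (p.prod ((volume : Measure unitInterval).prod (Measure.pi ν))) (ν z) :=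
      (measurePreserving_eval ν z).comp (measurePreserving_snd.comp measurePreserving_snd)
    exact hq.quasiMeasurePreserving.ae h1
  rw [Measure.map_congr (hae.mono fun s hs => potential_apply_eq_switch f hs),
    ← hpres.map_eq, Measure.map_map (measurable_switch (measurableSet_movable z) (hf z))
      hpres.measurable]
  rfl

/-! ### Adding the instrument and assembling the model -/

/-- Attach an independent instrument to a vector of potential outcomes and treatments. -/
def attachInstr (q : ((Fin J → ℝ) × (InstrValues J J₀ → Fin J)) × InstrValues J J₀) :
    Latent J J₀ := (q.1.1, q.1.2, q.2)

theorem measurable_attachInstr : Measurable (attachInstr : _ → Latent J J₀) := by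
  unfold attachInstr
  fun_prop

theorem indepFun_map_attachInstr (R : Measure ((Fin J → ℝ) × (InstrValues J J₀ → Fin J)))
    (ρ : Measure (InstrValues J J₀)) [IsProbabilityMeasure R] [IsProbabilityMeasure ρ] :
    IndepFun (fun ω : Latent J J₀ => (ω.1, ω.2.1)) (fun ω : Latent J J₀ => ω.2.2)
      ((R.prod ρ).map attachInstr) := by
  have h := indepFun_prod (μ := R) (ν := ρ) measurable_id measurable_id
  rw [indepFun_iff_measure_inter_preimage_eq_mul] at h ⊢
  intro s t hs ht
  have h1 : MeasurableSet ((fun ω : Latent J J₀ => (ω.1, ω.2.1)) ⁻¹' s) :=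
    (by fun_prop : Measurable fun ω : Latent J J₀ => (ω.1, ω.2.1)) hs
  have h2 : MeasurableSet ((fun ω : Latent J J₀ => ω.2.2) ⁻¹' t) :=
    (by fun_prop : Measurable fun ω : Latent J J₀ => ω.2.2) ht
  rw [Measure.map_apply measurable_attachInstr (h1.inter h2),
    Measure.map_apply measurable_attachInstr h1, Measure.map_apply measurable_attachInstr h2]
  exact h s t hs ht

/-- Splitting along the values of `Z`, `P` is determined by the law of `Z` and the conditional laws
of `(Y, D)`, and independence lets `R` supply the latter. -/
theorem map_observe_attachInstr {P : Measure (Observed J J₀)} [IsProbabilityMeasure P]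
    (hP : ∀ z : InstrValues J J₀, 0 < P {p | p.2.2 = z})
    (R : Measure ((Fin J → ℝ) × (InstrValues J J₀ → Fin J))) [IsProbabilityMeasure R]
    (hR : ∀ z, Measure.map (fun q => (q.1 (q.2 z), q.2 z)) R = condLaw P z) :
    ((R.prod (P.map fun p => p.2.2)).map attachInstr).map (observe J J₀) = P := by
  have hZ : Measurable fun p : Observed J J₀ => p.2.2 := by fun_prop
  have : IsProbabilityMeasure (P.map fun p => p.2.2) :=
    Measure.isProbabilityMeasure_map hZ.aemeasurable
  have hg : ∀ z : InstrValues J J₀, Measurable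
      fun q : (Fin J → ℝ) × (InstrValues J J₀ → Fin J) => (q.1 (q.2 z), q.2 z) := by
    intro z
    have h : Measurable fun q : (Fin J → ℝ) × Fin J => q.1 q.2 :=
      measurable_from_prod_countable_left fun d => measurable_pi_apply d
    have hd : Measurable fun q : (Fin J → ℝ) × (InstrValues J J₀ → Fin J) => q.2 z := by fun_prop
    exact (h.comp (measurable_fst.prodMk hd)).prodMk hd
  have hsec : ∀ (z : InstrValues J J₀) (S : Set (Observed J J₀)), MeasurableSet S →
      MeasurableSet {x : ℝ × Fin J | (x.1, x.2, z) ∈ S} := fun z S hS =>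
    (measurable_fst.prodMk (measurable_snd.prodMk measurable_const)) hS
  have hm := measurable_observe J J₀
  refine Measure.ext fun S hS => ?_
  rw [Measure.map_apply hm hS, Measure.map_apply measurable_attachInstr (hm hS)]
  have hU1 : attachInstr ⁻¹' (observe J J₀ ⁻¹' S) = ⋃ z : InstrValues J J₀,
      ((fun q : (Fin J → ℝ) × (InstrValues J J₀ → Fin J) => (q.1 (q.2 z), q.2 z)) ⁻¹'
        {x | (x.1, x.2, z) ∈ S}) ×ˢ {z} := by
    ext ⟨⟨y, d⟩, z⟩
    simp only [attachInstr, observe, Set.mem_preimage, Set.mem_iUnion, Set.mem_prod,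
      Set.mem_ofPred_eq, Set.mem_singleton_iff]
    exact ⟨fun h => ⟨z, h, rfl⟩, fun ⟨i, h, hi⟩ => hi ▸ h⟩
  have hU2 : S = ⋃ z : InstrValues J J₀, {p | p.2.2 = z} ∩ S := by
    ext p
    simp
  rw [hU1]
  conv_rhs => rw [hU2]
  rw [measure_iUnion _ fun z => (hg z (hsec z S hS)).prod (measurableSet_singleton z),
    measure_iUnion _ fun z => (measurableSet_instr z).inter hS]
  · refine tsum_congr fun z => ?_
    rw [apply_inter_instr_eq P (hP z) hS, Measure.prod_prod,
      Measure.map_apply hZ (measurableSet_singleton z), ← hR z,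
      Measure.map_apply (hg z) (hsec z S hS), mul_comm]
    rfl
  · exact fun i j hij => Set.disjoint_left.2 fun p hi hj => hij (hi.1.symm.trans hj.1)
  · exact fun i j hij => Set.disjoint_left.2 fun p hi hj => hij (hi.2.symm.trans hj.2)

/-- A rationalisation of the law of `(Y, D)` given `Z = z` by switching away from the base law. -/
theorem exists_switch_condLaw {P : Measure (Observed J J₀)} [IsProbabilityMeasure P]
    (hP : ∀ z : InstrValues J J₀, 0 < P {p | p.2.2 = z})
    (hT : TargetDominates P) (hB : BaseDominates P) (z : InstrValues J J₀) :
    ∃ (f : ℝ × Fin J → unitInterval) (ν : Measure (ℝ × Fin J)), Measurable f ∧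
      IsProbabilityMeasure ν ∧ ν (movable z) = 0 ∧ (z = base J J₀ → ∀ x, f x = 1) ∧
      Measure.map (switch (movable z) f)
        ((condLaw P (base J J₀)).prod ((volume : Measure unitInterval).prod ν)) =
          condLaw P z := by
  have hp := isProbabilityMeasure_condLaw P (hP (base J J₀))
  have hq := isProbabilityMeasure_condLaw P (hP z)
  by_cases hz : z = base J J₀
  -- A threshold of one is never exceeded, so the base value never switches and `D_0` is the default
  -- choice at every seed.
  · refine ⟨fun _ => 1, Measure.dirac (0, z.val), measurable_const, inferInstance, ?_,
      fun _ _ => rfl, ?_⟩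
    · rw [Measure.dirac_apply' _ (measurableSet_movable z)]
      simp [movable]
    · have : switch (movable z) (fun _ => 1) = Prod.fst := by
        funext t
        simp [switch, not_lt.2 unitInterval.le_one']
      rw [this, Measure.map_fst_prod, measure_univ, one_smul, hz]
  · have hzJ : J₀ ≤ z.val.val := z.2.resolve_left fun h => hz (Subtype.ext h)
    have h1 : (condLaw P z).restrict (movable z) ≤
        (condLaw P (base J J₀)).restrict (movable z) :=
      condLaw_restrict_le fun j hj B hBm => hB.condProb_le hBm hzJ hj
    have h2 : (condLaw P (base J J₀)).restrict (movable z)ᶜ ≤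
        (condLaw P z).restrict (movable z)ᶜ := by
      have hc : (movable z)ᶜ = Prod.snd ⁻¹' {z.val} := by simp [movable]
      rw [hc]
      refine condLaw_restrict_le fun j hj B hBm => ?_
      rw [Set.mem_singleton_iff.1 hj]
      -- Off the movable set the choice is `z`, and only the comparison of `z` with the base value
      -- is used.
      exact hT.condProb_le hBm hzJ (Ne.symm hz)
    obtain ⟨f, ν, hf, hν, hν0, h⟩ := exists_map_switch_eq _ _ (measurableSet_movable z)
      ⟨(0, z.val), by simp [movable]⟩ h1 h2
    exact ⟨f, ν, hf, hν, hν0, fun h => absurd h hz, h⟩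

theorem exists_isModel_map_observe_eq {P : Measure (Observed J J₀)} [IsProbabilityMeasure P]
    (hP : ∀ z : InstrValues J J₀, 0 < P {p | p.2.2 = z})
    (hT : TargetDominates P) (hB : BaseDominates P) :
    ∃ Q, IsModel J J₀ Q ∧ Measure.map (observe J J₀) Q = P := by
  choose f ν hf hν hν0 hf1 hmap using exists_switch_condLaw hP hT hB
  have hp := isProbabilityMeasure_condLaw P (hP (base J J₀))
  set κ := (condLaw P (base J J₀)).prod ((volume : Measure unitInterval).prod (Measure.pi ν))
  have hpot := measurable_potential hf
  have hR : IsProbabilityMeasure (κ.map (potential f)) :=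
    Measure.isProbabilityMeasure_map hpot.aemeasurable
  have hZ : Measurable fun p : Observed J J₀ => p.2.2 := by fun_prop
  have hρ : IsProbabilityMeasure (P.map fun p => p.2.2) :=
    Measure.isProbabilityMeasure_map hZ.aemeasurable
  have hobs := map_observe_attachInstr hP (κ.map (potential f)) fun z => by
    rw [← hmap z, ← map_potential_eq _ hf ν z (hν0 z), Measure.map_map _ hpot]
    · rfl
    · have h : Measurable fun q : (Fin J → ℝ) × Fin J => q.1 q.2 :=
        measurable_from_prod_countable_left fun d => measurable_pi_apply d
      have hd : Measurable fun q : (Fin J → ℝ) × (InstrValues J J₀ → Fin J) => q.2 z := by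
        fun_prop
      exact (h.comp (measurable_fst.prodMk hd)).prodMk hd
  refine ⟨_, ⟨Measure.isProbabilityMeasure_map measurable_attachInstr.aemeasurable,
    indepFun_map_attachInstr _ _, fun z => ?_, ?_⟩, hobs⟩
  · have h := hP z
    rw [← hobs, Measure.map_apply (measurable_observe J J₀) (measurableSet_instr z)] at h
    exact h
  · refine ⟨fun ω => ω.2.1 (base J J₀), by fun_prop, fun _ => ae_of_all _ fun _ => rfl,
      fun z => ?_⟩
    have hmeas : MeasurableSet {ω : Latent J J₀ | ω.2.1 z = z.val ∨
        ω.2.1 z = ω.2.1 (base J J₀)} :=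
      (measurableSet_eq_fun (by fun_prop) measurable_const).union
        (measurableSet_eq_fun (by fun_prop) (by fun_prop))
    rw [ae_map_iff measurable_attachInstr.aemeasurable hmeas]
    have hκ : ∀ᵐ q ∂(κ.map (potential f)), q.2 z = z.val ∨ q.2 z = q.2 (base J J₀) := by
      have hmeas' : MeasurableSet {q : (Fin J → ℝ) × (InstrValues J J₀ → Fin J) |
          q.2 z = z.val ∨ q.2 z = q.2 (base J J₀)} :=
        (measurableSet_eq_fun (by fun_prop) measurable_const).union
          (measurableSet_eq_fun (by fun_prop) (by fun_prop))
      rw [ae_map_iff hpot.aemeasurable hmeas']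
      refine ae_of_all _ fun s => ?_
      have h0 : (potential f s).2 (base J J₀) = s.1.2 := by
        simp [potential, hf1 _ rfl, not_lt.2 unitInterval.le_one']
      rw [h0]
      by_cases h : s.1 ∈ movable z ∧ f z s.1 < s.2.1
      · exact Or.inl (if_pos h)
      · exact Or.inr (if_neg h)
    exact Measure.quasiMeasurePreserving_fst.ae hκ

end Encouragement

theorem mainTheorem5 (J J₀ : ℕ) [NeZero J] (hJ₀ : 0 < J₀) (hJ : J₀ < J)
    (P : Measure (Encouragement.Observed J J₀)) [IsProbabilityMeasure P]
    (hP : ∀ z : Encouragement.InstrValues J J₀, 0 < P {p | p.2.2 = z}) :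
    P ∈ (fun Q => Measure.map (Encouragement.observe J J₀) Q) '' Encouragement.Model J J₀ ↔
      Encouragement.TargetDominates P ∧ Encouragement.BaseDominates P := by
  constructor
  · rintro ⟨Q, hQ, rfl⟩
    exact ⟨Encouragement.IsModel.targetDominates hQ, Encouragement.IsModel.baseDominates hJ₀ hQ⟩
  · rintro ⟨hT, hB⟩
    exact Encouragement.exists_isModel_map_observe_eq hP hT hB
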